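/- Let $\nu>-1/2$, $0\le|\beta|<\alpha$, $\mu\in\mathbb{R}$, and let $X\sim \mathrm{VG}(\nu,\alpha,\beta,\mu)$, that is, $X$ is a real random variable with probability density function \[p(x)=\frac{(\alpha^2-\beta^2)^{\nu+1/2}}{\sqrt{\pi}(2\alpha)^\nu\Gamma(\nu+1/2)}\,\mathrm{e}^{\beta(x-\mu)}|x-\mu|^\nu K_\nu(\alpha|x-\mu|),\quad x\in\mathbb{R},\qquad K_\nu(y)=\int_0^\infty \mathrm{e}^{-y\cosh t}\cosh(\nu t)\,\mathrm{d}t\quad (y>0)\] (this $p$ does integrate to $1$). Let $F_X(x)=\mathbb{P}(X\le x)$. For $y>0$ put \[\tilde t_{m,\nu}(y)=\sum_{j=0}^\infty\frac{(y/2)^{m+2j+1}}{\Gamma\big(j+\frac{m-\nu+3}{2}\big)\Gamma\big(j+\frac{m+\nu+3}{2}\big)}\] (the normalised modified Lommel function of the first kind), and, for $m\ge\nu>-1/2$, \[G_{m,\nu}(y)=y\big(K_\nu(y)\tilde t_{m-1,\nu-1}(y)+K_{\nu-1}(y)\tilde t_{m,\nu}(y)\big),\qquad \tilde G_{m,\nu}(y)=1-G_{m,\nu}(y),\]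 with $G_{m,\nu}(0)=0$ and $\tilde G_{m,\nu}(0)=1$ (the limits as $y\downarrow0$). Then all the series over $k$ below converge absolutely, and: (1) for $x\ge\mu$, \[F_X(x)=1-\frac{(1-\beta^2/\alpha^2)^{\nu+1/2}}{2\sqrt{\pi}\,\Gamma(\nu+1/2)}\sum_{k=0}^\infty\frac{1}{k!}\Big(\frac{2\beta}{\alpha}\Big)^k\Gamma\Big(\frac{k+1}{2}\Big)\Gamma\Big(\nu+\frac{k+1}{2}\Big)\tilde G_{\nu+k,\nu}(\alpha(x-\mu));\] (2) for $x<\mu$, \[F_X(x)=\frac{(1-\beta^2/\alpha^2)^{\nu+1/2}}{2\sqrt{\pi}\,\Gamma(\nu+1/2)}\sum_{k=0}^\infty\frac{(-1)^k}{k!}\Big(\frac{2\beta}{\alpha}\Big)^k\Gamma\Big(\frac{k+1}{2}\Big)\Gamma\Big(\nu+\frac{k+1}{2}\Big)\tilde G_{\nu+k,\nu}(-\alpha(x-\mu));\] (3) for all $x\in\mathbb{R}$, \[F_X(x)=\frac12-\frac{\Gamma(\nu+1)}{\sqrt{\pi}\,\Gamma(\nu+1/2)}\frac{\beta}{\alpha}\Big(1-\frac{\beta^2}{\alpha^2}\Big)^{\nu+1/2}{}_2F_1\Big(1,\nu+1;\frac32;\frac{\beta^2}{\alpha^2}\Big)\]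 \[\qquad+\frac{(1-\beta^2/\alpha^2)^{\nu+1/2}}{2\sqrt{\pi}\,\Gamma(\nu+1/2)}\sum_{k=0}^\infty\frac{(\mathrm{sgn}(x-\mu))^{k+1}}{k!}\Big(\frac{2\beta}{\alpha}\Big)^k\Gamma\Big(\frac{k+1}{2}\Big)\Gamma\Big(\nu+\frac{k+1}{2}\Big)G_{\nu+k,\nu}(\alpha|x-\mu|),\] where ${}_2F_1$ is the Gaussian hypergeometric function and $\mathrm{sgn}(0)=0$. -/

import Mathlib

open MeasureTheory

noncomputable section

namespace VarianceGamma

/-- The modified Bessel function of the second kind,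
`K_ν(x) = ∫₀^∞ exp(-x cosh t) cosh(ν t) dt`, for `x > 0`. -/
def besselK (ν x : ℝ) : ℝ :=
  ∫ t in Set.Ioi (0 : ℝ), Real.exp (-x * Real.cosh t) * Real.cosh (ν * t)

/-- The normalised modified Lommel function of the first kind,
`t̃_{m,ν}(x) = ∑ j, (x/2)^(m+2j+1) / (Γ(j+(m-ν+3)/2) Γ(j+(m+ν+3)/2))`, for `x > 0`.
It is the modified Lommel function `t_{m,ν}(x)` divided by
`2^(m-1) Γ((m-ν+1)/2) Γ((m+ν+1)/2)`; in the form below it also makes sense where one of these two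
gamma factors has a pole (which happens for `t̃_{m-1,ν-1}` with `m = ν = 1/2`). -/
def lommelT (m ν x : ℝ) : ℝ :=
  ∑' j : ℕ, (x / 2) ^ (m + 2 * (j : ℝ) + 1) /
    (Real.Gamma ((j : ℝ) + (m - ν + 3) / 2) * Real.Gamma ((j : ℝ) + (m + ν + 3) / 2))

/-- `G_{m,ν}(x) = x (K_ν(x) t̃_{m-1,ν-1}(x) + K_{ν-1}(x) t̃_{m,ν}(x))` for `x > 0`.
Because of the factor `x`, the formula gives the value `0` at `x = 0`, which is the limit of
`G_{m,ν}(x)` as `x ↓ 0` when `m ≥ ν > -1/2`. -/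
def lommelG (m ν x : ℝ) : ℝ :=
  x * (besselK ν x * lommelT (m - 1) (ν - 1) x + besselK (ν - 1) x * lommelT m ν x)

/-- `G̃_{m,ν}(x) = 1 - G_{m,ν}(x)`. -/
def lommelGt (m ν x : ℝ) : ℝ := 1 - lommelG m ν x

/-- The normalising constant
`M = (α² - β²)^(ν+1/2) / (√π (2α)^ν Γ(ν+1/2))` of the variance-gamma density. -/
def vgNorm (ν α β : ℝ) : ℝ :=
  (α ^ 2 - β ^ 2) ^ (ν + 1 / 2) / (√Real.pi * (2 * α) ^ ν * Real.Gamma (ν + 1 / 2))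

/-- The variance-gamma density
`p(x) = M exp(β (x-μ)) |x-μ|^ν K_ν(α |x-μ|)`. -/
def vgPDF (ν α β μ x : ℝ) : ℝ :=
  vgNorm ν α β * Real.exp (β * (x - μ)) * |x - μ| ^ ν * besselK ν (α * |x - μ|)

/-- The variance-gamma distribution `VG(ν, α, β, μ)`. -/
def vgMeasure (ν α β μ : ℝ) : Measure ℝ :=
  volume.withDensity fun x => ENNReal.ofReal (vgPDF ν α β μ x)

/-- The prefactor `(1 - β²/α²)^(ν+1/2) / (2 √π Γ(ν+1/2))` of the series. -/
def vgPrefactor (ν α β : ℝ) : ℝ :=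
  (1 - β ^ 2 / α ^ 2) ^ (ν + 1 / 2) / (2 * √Real.pi * Real.Gamma (ν + 1 / 2))

/-- The coefficient `(1/k!) (2β/α)^k Γ((k+1)/2) Γ(ν+(k+1)/2)` of the series. -/
def vgCoeff (ν α β : ℝ) (k : ℕ) : ℝ :=
  1 / (k.factorial : ℝ) * (2 * β / α) ^ k *
    Real.Gamma (((k : ℝ) + 1) / 2) * Real.Gamma (ν + ((k : ℝ) + 1) / 2)

end VarianceGamma

end

/-!
The distribution function of the variance-gamma law is computed by expanding the factor
`exp (β (x - μ))` of the density in powers of `β` and integrating term by term, so that everything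
rests on the tail integrals `∫_y^∞ tᵐ K_ν(t) dt` with `m = ν + k`.

* The function `G_{m,ν}` is, up to the constant `2^(m-1) Γ((m-ν+1)/2) Γ((m+ν+1)/2)`, a primitive of
  `tᵐ K_ν(t)` that vanishes at the origin (`hasDerivAt_lommelG`, `tendsto_lommelG_zero`). The
  derivative is computed from the first-order relations satisfied by `K_ν`, `K_{ν-1}` and by
  `t̃_{m,ν}`, `t̃_{m-1,ν-1}`.
* The same constant is the full integral `∫_0^∞ tᵐ K_ν(t) dt`
  (`integrableOn_and_integral_rpow_mul_besselK`), so the tail integrals are this constant times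
  `G̃_{m,ν}` (`integral_Ioi_rpow_mul_besselK`).
* The interchange of sum and integral (`hasSum_integral_vgHalfPDF`) needs only that the coefficient
  series converges absolutely. By the duplication formula its even part is a binomial series, and
  its odd part a series `₂F₁(1, ν+1; 3/2; β²/α²)`; hence its sum is `1/2 + vgSkew ν α β`
  (`hasSum_vgCoeff`). As `vgSkew` is odd in `β`, the two half-lines carry total mass one.

The half-line to the left of `μ` is reduced to the one on the right by the reflection that exchanges
`β` and `-β`. Writing `G̃ = 1 - G` in the two tail formulas gives the formula with the hypergeometric
function.
-/

namespace VarianceGamma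

open Filter Topology Set
open scoped Real

/-! ### The modified Bessel function of the second kind -/

/-- The power decay of `exp (-x cosh t)` in `x`, bought with exponential decay in `t`. Every
integrability statement about the Bessel integral, and the behaviour of `K_ν` at the origin, follow
from this bound by choosing `a` large enough. -/
lemma exp_neg_mul_cosh_le {a x : ℝ} (ha : 0 < a) (hx : 0 < x) (t : ℝ) :
    Real.exp (-x * Real.cosh t) ≤ (2 * a / x) ^ a * Real.exp (-a * t) := by
  have h1 : Real.exp t * (x / (2 * a)) ≤ Real.exp (x * Real.cosh t / a) := by
    have hc : Real.exp t / 2 ≤ Real.cosh t := by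
      rw [Real.cosh_eq]; linarith [Real.exp_pos (-t)]
    have h := Real.add_one_le_exp (x * Real.cosh t / a)
    have h2 : Real.exp t * (x / (2 * a)) ≤ x * Real.cosh t / a := by
      have : Real.exp t * (x / (2 * a)) = x * (Real.exp t / 2) / a := by ring
      rw [this]; gcongr
    linarith
  have h2 := Real.rpow_le_rpow (by positivity) h1 ha.le
  rw [Real.mul_rpow (Real.exp_pos _).le (by positivity), ← Real.exp_mul, ← Real.exp_mul,
    div_mul_cancel₀ _ ha.ne'] at h2
  have h3 : (2 * a / x) ^ a * (x / (2 * a)) ^ a = 1 := by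
    rw [← Real.mul_rpow (by positivity) (by positivity)]
    have : 2 * a / x * (x / (2 * a)) = 1 := by field_simp
    rw [this, Real.one_rpow]
  have h4 := mul_le_mul_of_nonneg_left h2
    (show 0 ≤ (2 * a / x) ^ a * Real.exp (-a * t) * Real.exp (-x * Real.cosh t) by positivity)
  have e1 : Real.exp (-a * t) * Real.exp (t * a) = 1 := by
    rw [← Real.exp_add]; simp [mul_comm]
  have e2 : Real.exp (-x * Real.cosh t) * Real.exp (x * Real.cosh t) = 1 := by
    rw [← Real.exp_add]; simp
  calc Real.exp (-x * Real.cosh t)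
      = (2 * a / x) ^ a * Real.exp (-a * t) * Real.exp (-x * Real.cosh t) *
          (Real.exp (t * a) * (x / (2 * a)) ^ a) := by
        linear_combination (-Real.exp (-x * Real.cosh t)) * h3 -
          (2 * a / x) ^ a * (x / (2 * a)) ^ a * Real.exp (-x * Real.cosh t) * e1
    _ ≤ _ := h4
    _ = _ := by linear_combination (2 * a / x) ^ a * Real.exp (-a * t) * e2

lemma cosh_mul_le_exp (ν : ℝ) {t : ℝ} (ht : 0 ≤ t) : Real.cosh (ν * t) ≤ Real.exp (|ν| * t) := by
  rw [← Real.cosh_abs, abs_mul, abs_of_nonneg ht, Real.cosh_eq]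
  have : Real.exp (-(|ν| * t)) ≤ Real.exp (|ν| * t) :=
    Real.exp_le_exp.2 (by nlinarith [mul_nonneg (abs_nonneg ν) ht])
  linarith

lemma besselK_integrand_le {a ν x t : ℝ} (ha : |ν| < a) (hx : 0 < x) (ht : 0 ≤ t) :
    Real.exp (-x * Real.cosh t) * Real.cosh (ν * t) ≤
      (2 * a / x) ^ a * Real.exp ((|ν| - a) * t) := by
  have ha0 : 0 < a := (abs_nonneg ν).trans_lt ha
  calc _ ≤ (2 * a / x) ^ a * Real.exp (-a * t) * Real.exp (|ν| * t) :=
        mul_le_mul (exp_neg_mul_cosh_le ha0 hx t) (cosh_mul_le_exp ν ht) (Real.cosh_pos _).le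
          (by positivity)
    _ = _ := by rw [mul_assoc, ← Real.exp_add]; ring_nf

lemma integrableOn_besselK (ν : ℝ) {x : ℝ} (hx : 0 < x) :
    IntegrableOn (fun t => Real.exp (-x * Real.cosh t) * Real.cosh (ν * t)) (Ioi 0) := by
  have ha : |ν| < |ν| + 1 := by linarith
  refine Integrable.mono' ((integrableOn_exp_mul_Ioi (a := |ν| - (|ν| + 1)) (by linarith) 0).const_mul
    ((2 * (|ν| + 1) / x) ^ (|ν| + 1))) (by fun_prop) ?_
  filter_upwards [ae_restrict_mem measurableSet_Ioi] with t ht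
  rw [Real.norm_of_nonneg (mul_nonneg (Real.exp_pos _).le (Real.cosh_pos _).le)]
  exact besselK_integrand_le ha hx (le_of_lt ht)

lemma besselK_nonneg (ν x : ℝ) : 0 ≤ besselK ν x :=
  integral_nonneg fun _ => mul_nonneg (Real.exp_pos _).le (Real.cosh_pos _).le

lemma besselK_le {a ν x : ℝ} (ha : |ν| < a) (hx : 0 < x) :
    besselK ν x ≤ (2 * a) ^ a / (a - |ν|) * x ^ (-a) := by
  have ha0 : 0 < a := (abs_nonneg ν).trans_lt ha
  have h : besselK ν x ≤ ∫ t in Ioi (0 : ℝ), (2 * a / x) ^ a * Real.exp ((|ν| - a) * t) :=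
    setIntegral_mono_on (integrableOn_besselK ν hx)
      ((integrableOn_exp_mul_Ioi (by linarith) 0).const_mul _) measurableSet_Ioi
      fun t ht => besselK_integrand_le ha hx (le_of_lt ht)
  refine h.trans_eq ?_
  rw [integral_const_mul, integral_exp_mul_Ioi (by linarith), Real.div_rpow (by positivity) hx.le,
    Real.rpow_neg hx.le]
  have : |ν| - a ≠ 0 := by linarith
  have h' : a - |ν| ≠ 0 := by linarith
  have : (x ^ a) ≠ 0 := (Real.rpow_pos_of_pos hx a).ne'
  simp only [mul_zero, Real.exp_zero]
  have h3 : |ν| - a = -(a - |ν|) := by ring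
  rw [h3]
  field_simp

lemma measurable_besselK (ν : ℝ) : Measurable (besselK ν) := by
  have : StronglyMeasurable (fun p : ℝ × ℝ => Real.exp (-p.1 * Real.cosh p.2) * Real.cosh (ν * p.2)) :=
    (by fun_prop : Continuous _).stronglyMeasurable
  exact (this.integral_prod_right' (ν := volume.restrict (Ioi (0 : ℝ)))).measurable

lemma cosh_mul_cosh (ν t : ℝ) : Real.cosh t * Real.cosh (ν * t) =
    (Real.cosh ((ν + 1) * t) + Real.cosh ((ν - 1) * t)) / 2 := by
  have h1 : (ν + 1) * t = ν * t + t := by ring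
  have h2 : (ν - 1) * t = ν * t - t := by ring
  rw [h1, h2, Real.cosh_add, Real.cosh_sub]; ring

lemma sinh_mul_sinh (ν t : ℝ) : Real.sinh t * Real.sinh (ν * t) =
    (Real.cosh ((ν + 1) * t) - Real.cosh ((ν - 1) * t)) / 2 := by
  have h1 : (ν + 1) * t = ν * t + t := by ring
  have h2 : (ν - 1) * t = ν * t - t := by ring
  rw [h1, h2, Real.cosh_add, Real.cosh_sub]; ring

lemma hasDerivAt_besselK_add (ν : ℝ) {x : ℝ} (hx : 0 < x) :
    HasDerivAt (besselK ν) (-(besselK (ν + 1) x + besselK (ν - 1) x) / 2) x := by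
  have key := hasDerivAt_integral_of_dominated_loc_of_deriv_le
    (μ := volume.restrict (Ioi (0 : ℝ))) (x₀ := x) (s := Ioi (x / 2))
    (F := fun y t => Real.exp (-y * Real.cosh t) * Real.cosh (ν * t))
    (F' := fun y t => -(Real.exp (-y * Real.cosh t) * Real.cosh ((ν + 1) * t) +
      Real.exp (-y * Real.cosh t) * Real.cosh ((ν - 1) * t)) / 2)
    (bound := fun t => (Real.exp (-(x / 2) * Real.cosh t) * Real.cosh ((ν + 1) * t) +
      Real.exp (-(x / 2) * Real.cosh t) * Real.cosh ((ν - 1) * t)) / 2)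
    (Ioi_mem_nhds (by linarith)) (Eventually.of_forall fun y => by fun_prop)
    (integrableOn_besselK ν hx) (by fun_prop) ?_ ?_ ?_
  · refine key.2.congr_deriv ?_
    rw [integral_div, integral_neg,
      integral_add (integrableOn_besselK _ hx) (integrableOn_besselK _ hx)]
    rfl
  · refine Eventually.of_forall fun t y hy => ?_
    have hy' : x / 2 < y := hy
    have h1 := (Real.cosh_pos ((ν + 1) * t)).le
    have h2 := (Real.cosh_pos ((ν - 1) * t)).le
    rw [Real.norm_eq_abs, neg_div, abs_neg, abs_of_nonneg (by positivity)]
    have : -y * Real.cosh t ≤ -(x / 2) * Real.cosh t := by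
      nlinarith [Real.cosh_pos t]
    gcongr
  · exact ((integrableOn_besselK _ (half_pos hx)).add
      (integrableOn_besselK _ (half_pos hx))).div_const 2
  · refine Eventually.of_forall fun t y hy => ?_
    have h : HasDerivAt (fun y : ℝ => Real.exp (-y * Real.cosh t) * Real.cosh (ν * t))
        (Real.exp (-y * Real.cosh t) * (-1 * Real.cosh t) * Real.cosh (ν * t)) y :=
      (((hasDerivAt_id y).neg.mul_const (Real.cosh t)).exp).mul_const _
    refine h.congr_deriv ?_
    linear_combination (-Real.exp (-y * Real.cosh t)) * cosh_mul_cosh ν t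

/-- The recurrence `K_{ν+1} - K_{ν-1} = (2ν/x) K_ν`, an integration by parts in the integral that
defines `K_ν`. -/
lemma besselK_recurrence (ν : ℝ) {x : ℝ} (hx : 0 < x) :
    2 * ν * besselK ν x = x * (besselK (ν + 1) x - besselK (ν - 1) x) := by
  have hi1 := (integrableOn_besselK ν hx).const_mul ν
  have hi2 : IntegrableOn (fun t => x / 2 * (Real.exp (-x * Real.cosh t) * Real.cosh ((ν + 1) * t) -
      Real.exp (-x * Real.cosh t) * Real.cosh ((ν - 1) * t))) (Ioi 0) :=
    ((integrableOn_besselK (ν + 1) hx).sub (integrableOn_besselK (ν - 1) hx)).const_mul (x / 2)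
  have key := integral_Ioi_of_hasDerivAt_of_tendsto (a := 0) (m := 0)
    (f := fun t => Real.exp (-x * Real.cosh t) * Real.sinh (ν * t))
    (f' := fun t => ν * (Real.exp (-x * Real.cosh t) * Real.cosh (ν * t)) -
      x / 2 * (Real.exp (-x * Real.cosh t) * Real.cosh ((ν + 1) * t) -
        Real.exp (-x * Real.cosh t) * Real.cosh ((ν - 1) * t)))
    (by fun_prop) ?_ (hi1.sub hi2) ?_
  · rw [integral_sub hi1 hi2, integral_const_mul, integral_const_mul,
      integral_sub (integrableOn_besselK _ hx) (integrableOn_besselK _ hx)] at key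
    simp only [mul_zero, Real.sinh_zero, sub_zero] at key
    change ν * besselK ν x - x / 2 * (besselK (ν + 1) x - besselK (ν - 1) x) = 0 at key
    linear_combination 2 * key
  · intro t _
    have h1 : HasDerivAt (fun t : ℝ => Real.exp (-x * Real.cosh t))
        (Real.exp (-x * Real.cosh t) * (-x * Real.sinh t)) t :=
      ((Real.hasDerivAt_cosh t).const_mul (-x)).exp
    have h2 : HasDerivAt (fun t : ℝ => Real.sinh (ν * t)) (Real.cosh (ν * t) * (ν * 1)) t :=
      ((hasDerivAt_id t).const_mul ν).sinh
    refine (h1.mul h2).congr_deriv ?_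
    linear_combination (-x * Real.exp (-x * Real.cosh t)) * sinh_mul_sinh ν t
  · have hlim : Tendsto (fun t => (2 * (|ν| + 1) / x) ^ (|ν| + 1) *
        Real.exp ((|ν| - (|ν| + 1)) * t)) atTop (𝓝 0) := by
      have : Tendsto (fun t : ℝ => (|ν| - (|ν| + 1)) * t) atTop atBot :=
        tendsto_id.const_mul_atTop_of_neg (by linarith)
      simpa using (Real.tendsto_exp_atBot.comp this).const_mul ((2 * (|ν| + 1) / x) ^ (|ν| + 1))
    refine squeeze_zero_norm' ?_ hlim
    filter_upwards [eventually_ge_atTop 0] with t ht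
    refine le_trans ?_ (besselK_integrand_le (ν := ν) (by linarith) hx ht)
    rw [norm_mul, Real.norm_of_nonneg (Real.exp_pos _).le, Real.norm_eq_abs]
    gcongr
    rw [Real.abs_sinh, ← Real.cosh_abs (ν * t)]
    exact (Real.sinh_lt_cosh _).le

lemma hasDerivAt_besselK (ν : ℝ) {x : ℝ} (hx : 0 < x) :
    HasDerivAt (besselK ν) (-besselK (ν - 1) x - ν / x * besselK ν x) x := by
  refine (hasDerivAt_besselK_add ν hx).congr_deriv ?_
  have := besselK_recurrence ν hx
  field_simp
  linear_combination this

lemma hasDerivAt_besselK_sub_one (ν : ℝ) {x : ℝ} (hx : 0 < x) :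
    HasDerivAt (besselK (ν - 1)) (-besselK ν x + (ν - 1) / x * besselK (ν - 1) x) x := by
  refine (hasDerivAt_besselK_add (ν - 1) hx).congr_deriv ?_
  have := besselK_recurrence (ν - 1) hx
  rw [sub_add_cancel] at this ⊢
  field_simp
  linear_combination (-1 : ℝ) * this

/-- The representation `K_ν(x) = ½ ∫₀^∞ (2w/x)^ν exp(-w - x²/(4w)) dw/w`, obtained by
extending the integral to the whole line and substituting `w = (x/2) eᵗ`. -/
lemma besselK_eq_integral (ν : ℝ) {x : ℝ} (hx : 0 < x) :
    besselK ν x = 1 / 2 * ∫ w in Ioi (0 : ℝ),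
      (2 * w / x) ^ ν * Real.exp (-w - x ^ 2 / (4 * w)) / w := by
  have himg : (fun t => x / 2 * Real.exp t) '' univ = Ioi 0 := by
    ext w
    simp only [image_univ, mem_range, mem_Ioi]
    constructor
    · rintro ⟨t, rfl⟩; positivity
    · intro hw
      refine ⟨Real.log (2 * w / x), ?_⟩
      rw [Real.exp_log (by positivity)]; field_simp
  rw [← himg, integral_image_eq_integral_abs_deriv_smul (f' := fun t => x / 2 * Real.exp t)
    MeasurableSet.univ (fun t _ => ((Real.hasDerivAt_exp t).const_mul _).hasDerivWithinAt)
    (fun s _ t _ h => Real.exp_injective (mul_left_cancel₀ (by positivity) h)), setIntegral_univ]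
  have hpt : ∀ t : ℝ, |x / 2 * Real.exp t| • ((2 * (x / 2 * Real.exp t) / x) ^ ν *
      Real.exp (-(x / 2 * Real.exp t) - x ^ 2 / (4 * (x / 2 * Real.exp t))) /
        (x / 2 * Real.exp t)) = Real.exp (-x * Real.cosh t) * Real.exp (ν * t) := by
    intro t
    have h1 : 2 * (x / 2 * Real.exp t) / x = Real.exp t := by field_simp
    have h2 : -(x / 2 * Real.exp t) - x ^ 2 / (4 * (x / 2 * Real.exp t)) =
        -x * Real.cosh t := by
      rw [Real.cosh_eq, Real.exp_neg]; field_simp; ring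
    rw [h1, h2, abs_of_pos (by positivity), smul_eq_mul, ← Real.exp_mul, mul_comm t ν]
    field_simp
  simp_rw [hpt]
  have hG : ∀ s : ℝ, IntegrableOn (fun t => Real.exp (-x * Real.cosh t) * Real.exp (s * t))
      (Ioi 0) := fun s => by
    refine Integrable.mono' ((integrableOn_besselK s hx).const_mul 2) (by fun_prop)
      (Eventually.of_forall fun t => ?_)
    rw [Real.norm_of_nonneg (by positivity)]
    have : Real.exp (s * t) ≤ 2 * Real.cosh (s * t) := by
      rw [Real.cosh_eq]; linarith [Real.exp_pos (-(s * t))]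
    calc _ ≤ Real.exp (-x * Real.cosh t) * (2 * Real.cosh (s * t)) := by gcongr
      _ = _ := by ring
  have hneg : ∫ t in Iic (0 : ℝ), Real.exp (-x * Real.cosh t) * Real.exp (ν * t) =
      ∫ t in Ioi (0 : ℝ), Real.exp (-x * Real.cosh t) * Real.exp (-ν * t) := by
    rw [← neg_zero (G := ℝ), ← integral_comp_neg_Ioi]; simp
  have hIic : IntegrableOn (fun t => Real.exp (-x * Real.cosh t) * Real.exp (ν * t)) (Iic 0) := by
    have h := (integrableOn_Ici_iff_integrableOn_Ioi (by simp)).2 (hG (-ν))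
    rw [← neg_zero (G := ℝ)] at h
    simpa using h.comp_neg_Iic
  rw [← intervalIntegral.integral_Iic_add_Ioi hIic (hG ν), hneg, ← integral_add (hG _) (hG _),
    ← integral_const_mul, besselK]
  refine integral_congr_ae (Eventually.of_forall fun t => ?_)
  simp only [Real.cosh_eq (ν * t), neg_mul]
  ring

/-- The Mellin transform of `K_ν`: both integrations become gamma integrals once `K_ν` is replaced
by its representation `besselK_eq_integral` and the order of integration is exchanged. -/
lemma integrableOn_and_integral_rpow_mul_besselK {m ν : ℝ} (h1 : 0 < m - ν + 1)
    (h2 : 0 < m + ν + 1) :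
    IntegrableOn (fun x => x ^ m * besselK ν x) (Ioi 0) ∧
      ∫ x in Ioi (0 : ℝ), x ^ m * besselK ν x =
        2 ^ (m - 1) * Real.Gamma ((m - ν + 1) / 2) * Real.Gamma ((m + ν + 1) / 2) := by
  let F : ℝ → ℝ → ℝ := fun x w =>
    x ^ m * (1 / 2 * ((2 * w / x) ^ ν * Real.exp (-w - x ^ 2 / (4 * w)) / w))
  have hF : ∀ {x w : ℝ}, 0 < x → 0 < w → F x w = 2 ^ (ν - 1) * (w ^ (ν - 1) * Real.exp (-w)) *
      (x ^ (m - ν) * Real.exp (-(1 / (4 * w)) * x ^ (2 : ℝ))) := by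
    intro x w hx hw
    simp only [F]
    rw [Real.div_rpow (by positivity) hx.le, Real.mul_rpow (by norm_num) hw.le,
      Real.rpow_sub hx, Real.rpow_sub hw, Real.rpow_sub (by norm_num : (0 : ℝ) < 2),
      Real.rpow_one, Real.rpow_one, Real.rpow_two,
      show -w - x ^ 2 / (4 * w) = -w + -(1 / (4 * w)) * x ^ 2 by ring, Real.exp_add]
    ring
  have hinner : ∀ {w : ℝ}, 0 < w → ∫ x in Ioi (0 : ℝ), F x w =
      2 ^ (m - 1) * Real.Gamma ((m - ν + 1) / 2) *
        (Real.exp (-w) * w ^ ((m + ν + 1) / 2 - 1)) := by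
    intro w hw
    rw [setIntegral_congr_fun measurableSet_Ioi fun x hx => hF hx hw, integral_const_mul,
      integral_rpow_mul_exp_neg_mul_rpow (by norm_num) (by linarith) (by positivity)]
    have e1 : (1 / (4 * w)) ^ (-(m - ν + 1) / 2) = 2 ^ (m - ν + 1) * w ^ ((m - ν + 1) / 2) := by
      rw [neg_div, Real.rpow_neg (by positivity), one_div, Real.inv_rpow (by positivity), inv_inv,
        Real.mul_rpow (by norm_num) hw.le, show (4 : ℝ) = 2 ^ (2 : ℝ) by norm_num,
        ← Real.rpow_mul (by norm_num)]
      congr 2; ring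
    have e2 : w ^ ((m + ν + 1) / 2 - 1) = w ^ (ν - 1) * w ^ ((m - ν + 1) / 2) := by
      rw [← Real.rpow_add hw]; congr 1; ring
    have e3 : (2 : ℝ) ^ (m - 1) = 2 ^ (ν - 1) * 2 ^ (m - ν + 1) * (1 / 2) := by
      rw [← Real.rpow_add (by norm_num), one_div, ← Real.rpow_neg_one (2 : ℝ),
        ← Real.rpow_add (by norm_num)]
      congr 1; ring
    rw [e1, e2, e3]; ring
  have hmeas : Measurable (Function.uncurry F) := by
    simp only [F, Function.uncurry_def]; fun_prop
  have hprod : Integrable (Function.uncurry F)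
      ((volume.restrict (Ioi (0 : ℝ))).prod (volume.restrict (Ioi (0 : ℝ)))) := by
    refine (integrable_prod_iff' hmeas.aestronglyMeasurable).2 ⟨?_, ?_⟩
    · filter_upwards [ae_restrict_mem measurableSet_Ioi] with w hw
      have hw' : 0 < 1 / (4 * w) := by have : 0 < w := hw; positivity
      exact IntegrableOn.congr_fun ((integrableOn_rpow_mul_exp_neg_mul_rpow (s := m - ν) (p := 2)
        (by linarith) (by norm_num) hw').const_mul _) (fun x hx => (hF hx hw).symm)
          measurableSet_Ioi
    · refine IntegrableOn.congr_fun ((Real.GammaIntegral_convergent (s := (m + ν + 1) / 2)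
        (by linarith)).const_mul (2 ^ (m - 1) * Real.Gamma ((m - ν + 1) / 2))) (fun w hw => ?_)
          measurableSet_Ioi
      have hw' : 0 < w := hw
      rw [← hinner hw]
      refine setIntegral_congr_fun measurableSet_Ioi fun x hx => ?_
      have hx' : 0 < x := hx
      simp only [Function.uncurry_apply_pair]
      rw [Real.norm_of_nonneg]
      simp only [F]; positivity
  have hK : ∀ x ∈ Ioi (0 : ℝ), ∫ w in Ioi (0 : ℝ), F x w = x ^ m * besselK ν x := by
    intro x hx
    simp only [F]
    rw [integral_const_mul, integral_const_mul, besselK_eq_integral ν hx]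
  refine ⟨hprod.integral_prod_left.congr ?_, ?_⟩
  · filter_upwards [ae_restrict_mem measurableSet_Ioi] with x hx using hK x hx
  · rw [← setIntegral_congr_fun measurableSet_Ioi hK, integral_integral_swap hprod,
      setIntegral_congr_fun measurableSet_Ioi fun w hw => hinner hw, integral_const_mul,
      ← Real.Gamma_eq_integral (by linarith)]

/-! ### The modified Lommel function -/

/-- The entire function `z ↦ ∑ zʲ / (Γ(j+a) Γ(j+b))`. The function `t̃_{m,ν}` is a power of `x/2`
times this series at `x²/4`. -/
noncomputable def lommelSeries (a b z : ℝ) : ℝ :=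
  ∑' j : ℕ, z ^ j / (Real.Gamma (j + a) * Real.Gamma (j + b))

lemma summable_lommelSeries {a b : ℝ} (ha : 0 < a) (hb : 0 < b) (z : ℝ) :
    Summable fun j : ℕ => z ^ j / (Real.Gamma (j + a) * Real.Gamma (j + b)) := by
  refine summable_of_ratio_norm_eventually_le (r := 1 / 2) (by norm_num) ?_
  filter_upwards [eventually_ge_atTop ⌈2 * |z| + 1⌉₊] with j hj
  have hj' : 2 * |z| + 1 ≤ j := Nat.ceil_le.1 hj
  have h0 := abs_nonneg z
  have hja : 0 < (j : ℝ) + a := by positivity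
  have hjb : 0 < (j : ℝ) + b := by positivity
  have ga := Real.Gamma_pos_of_pos hja
  have gb := Real.Gamma_pos_of_pos hjb
  have e : z ^ (j + 1) / (Real.Gamma ((j + 1 : ℕ) + a) * Real.Gamma ((j + 1 : ℕ) + b)) =
      z / ((j + a) * (j + b)) * (z ^ j / (Real.Gamma (j + a) * Real.Gamma (j + b))) := by
    push_cast
    rw [add_right_comm (j : ℝ) 1 a, add_right_comm (j : ℝ) 1 b, Real.Gamma_add_one hja.ne',
      Real.Gamma_add_one hjb.ne', pow_succ]
    field_simp
  rw [e, norm_mul]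
  gcongr
  rw [norm_div, Real.norm_eq_abs, Real.norm_of_nonneg (by positivity), div_le_iff₀ (by positivity)]
  nlinarith [mul_pos ha hb, mul_pos ha hjb]

lemma lommelSeries_comm (a b z : ℝ) : lommelSeries a b z = lommelSeries b a z := by
  simp only [lommelSeries, mul_comm]

lemma lommelSeries_eq_add {a b : ℝ} (ha : 0 < a) (hb : 0 < b) (z : ℝ) :
    lommelSeries a b z =
      1 / (Real.Gamma a * Real.Gamma b) + z * lommelSeries (a + 1) (b + 1) z := by
  rw [lommelSeries, (summable_lommelSeries ha hb z).tsum_eq_zero_add, lommelSeries, ← tsum_mul_left]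
  congr 1
  · simp
  · refine tsum_congr fun j => ?_
    push_cast
    rw [add_right_comm (j : ℝ) 1 a, add_right_comm (j : ℝ) 1 b, pow_succ, add_assoc, add_assoc]
    ring

/-- Contiguity: `z φ'_{a,b+1}(z) + b φ_{a,b+1}(z) = φ_{a,b}(z)`, from termwise differentiation and
`Γ(j+b+1) = (j+b) Γ(j+b)`. -/
lemma hasDerivAt_lommelSeries {a b z : ℝ} (ha : 0 < a) (hb : 0 < b) (hz : z ≠ 0) :
    HasDerivAt (lommelSeries a (b + 1))
      ((lommelSeries a b z - b * lommelSeries a (b + 1) z) / z) z := by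
  have hb1 : 0 < b + 1 := by linarith
  set R : ℝ := |z| + 1 with hR
  have hR1 : 1 ≤ R := by linarith [abs_nonneg z]
  have hga : ∀ j : ℕ, 0 < Real.Gamma (j + a) := fun j => Real.Gamma_pos_of_pos (by positivity)
  have hgb : ∀ j : ℕ, 0 < Real.Gamma (j + (b + 1)) :=
    fun j => Real.Gamma_pos_of_pos (by positivity)
  have hmem : z ∈ Metric.ball (0 : ℝ) R := by simp [hR]
  have key := hasDerivAt_tsum_of_isPreconnected
    (g := fun (j : ℕ) y => y ^ j / (Real.Gamma (j + a) * Real.Gamma (j + (b + 1))))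
    (g' := fun (j : ℕ) y => j * y ^ (j - 1) / (Real.Gamma (j + a) * Real.Gamma (j + (b + 1))))
    (summable_lommelSeries ha hb1 (2 * R)) Metric.isOpen_ball
    (convex_ball (0 : ℝ) R).isPreconnected
    (fun j y _ => (hasDerivAt_pow j y).div_const _) ?_ hmem (summable_lommelSeries ha hb1 z) hmem
  · refine key.congr_deriv ?_
    rw [eq_div_iff hz, ← tsum_mul_right, lommelSeries, lommelSeries, ← tsum_mul_left,
      ← (summable_lommelSeries ha hb z).tsum_sub ((summable_lommelSeries ha hb1 z).mul_left b)]
    refine tsum_congr fun j => ?_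
    have hjb : 0 < (j : ℝ) + b := by positivity
    have := (hga j).ne'
    have := (Real.Gamma_pos_of_pos hjb).ne'
    rw [← add_assoc, Real.Gamma_add_one hjb.ne']
    rcases j with _ | j
    · simp only [CharP.cast_eq_zero, zero_add] at *; field_simp; ring
    · rw [Nat.add_sub_cancel, pow_succ]; field_simp; ring
  · intro j y hy
    have hy' : |y| ≤ R := by simpa using (mem_ball_zero_iff.1 hy).le
    rw [norm_div, Real.norm_of_nonneg (mul_pos (hga j) (hgb j)).le]
    refine div_le_div_of_nonneg_right ?_ (mul_pos (hga j) (hgb j)).le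
    rw [norm_mul, norm_pow, Real.norm_eq_abs, Real.norm_eq_abs, abs_of_nonneg (Nat.cast_nonneg j),
      mul_pow]
    gcongr
    · exact_mod_cast Nat.lt_two_pow_self.le
    · exact (pow_le_pow_left₀ (abs_nonneg y) hy' _).trans (pow_le_pow_right₀ hR1 (Nat.sub_le j 1))

lemma continuousAt_lommelSeries_zero {a b : ℝ} (ha : 0 < a) (hb : 0 < b) :
    ContinuousAt (lommelSeries a b) 0 := by
  have hga : ∀ j : ℕ, 0 < Real.Gamma (j + a) := fun j => Real.Gamma_pos_of_pos (by positivity)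
  have hgb : ∀ j : ℕ, 0 < Real.Gamma (j + b) := fun j => Real.Gamma_pos_of_pos (by positivity)
  refine (continuousOn_tsum (s := Metric.ball (0 : ℝ) 1) (fun j => by fun_prop)
    (summable_lommelSeries ha hb 1) fun j y hy => ?_).continuousAt (Metric.ball_mem_nhds 0 one_pos)
  rw [norm_div, Real.norm_of_nonneg (mul_pos (hga j) (hgb j)).le, norm_pow, Real.norm_eq_abs]
  refine div_le_div_of_nonneg_right (pow_le_pow_left₀ (abs_nonneg y) ?_ j) (mul_pos (hga j) (hgb j)).le
  simpa using (mem_ball_zero_iff.1 hy).le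

lemma lommelT_eq (m ν : ℝ) {x : ℝ} (hx : 0 < x) :
    lommelT m ν x =
      (x / 2) ^ (m + 1) * lommelSeries ((m - ν + 3) / 2) ((m + ν + 3) / 2) (x ^ 2 / 4) := by
  rw [lommelT, lommelSeries, ← tsum_mul_left]
  refine tsum_congr fun j => ?_
  have : (x / 2) ^ (m + 2 * (j : ℝ) + 1) = (x / 2) ^ (m + 1) * (x ^ 2 / 4) ^ j := by
    rw [show m + 2 * (j : ℝ) + 1 = (m + 1) + ((2 * j : ℕ) : ℝ) by push_cast; ring,
      Real.rpow_add (by positivity), Real.rpow_natCast, pow_mul]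
    congr 2; ring
  rw [this, mul_div_assoc]

lemma hasDerivAt_rpow_mul_lommelSeries (p : ℝ) {a b x : ℝ} (ha : 0 < a) (hb : 0 < b) (hx : 0 < x) :
    HasDerivAt (fun x : ℝ => (x / 2) ^ p * lommelSeries a (b + 1) (x ^ 2 / 4))
      ((p - 2 * b) / x * ((x / 2) ^ p * lommelSeries a (b + 1) (x ^ 2 / 4)) +
        (x / 2) ^ (p - 1) * lommelSeries a b (x ^ 2 / 4)) x := by
  have hq : HasDerivAt (fun x : ℝ => x ^ 2 / 4) (2 * x / 4) x := by
    simpa using (hasDerivAt_pow 2 x).div_const 4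
  have h1 := (hasDerivAt_lommelSeries (z := x ^ 2 / 4) ha hb (by positivity)).comp x hq
  have h2 : HasDerivAt (fun x : ℝ => (x / 2) ^ p) (1 / 2 * p * (x / 2) ^ (p - 1)) x :=
    ((hasDerivAt_id x).div_const 2).rpow_const (Or.inl (by simp [hx.ne']))
  refine (h2.mul h1).congr_deriv ?_
  have e : (x / 2) ^ p = (x / 2) ^ (p - 1) * (x / 2) := by
    rw [← Real.rpow_add_one (by positivity)]; ring_nf
  simp only [Function.comp_apply, e]
  field_simp
  ring

/-- The equation `t̃'_{m,ν} = t̃_{m-1,ν-1} - (ν/x) t̃_{m,ν}`. -/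
lemma hasDerivAt_lommelT {m ν x : ℝ} (h1 : 0 < m - ν + 1) (h2 : 0 < m + ν + 1) (hx : 0 < x) :
    HasDerivAt (lommelT m ν) (lommelT (m - 1) (ν - 1) x - ν / x * lommelT m ν x) x := by
  have h := hasDerivAt_rpow_mul_lommelSeries (m + 1) (a := (m - ν + 3) / 2)
    (b := (m + ν + 1) / 2) (by linarith) (by linarith) hx
  rw [show (m + ν + 1) / 2 + 1 = (m + ν + 3) / 2 by ring] at h
  rw [lommelT_eq m ν hx, lommelT_eq _ _ hx]
  refine (h.congr_of_eventuallyEq ?_).congr_deriv ?_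
  · filter_upwards [Ioi_mem_nhds hx] with y hy using lommelT_eq m ν hy
  · rw [show m - 1 - (ν - 1) + 3 = m - ν + 3 by ring, show m - 1 + (ν - 1) + 3 = m + ν + 1 by ring,
      show m + 1 - 1 = m by ring, show m - 1 + 1 = m by ring]
    ring

/-- The equation for `t̃'_{m-1,ν-1}`, with the inhomogeneous term that makes Lommel functions differ
from Bessel functions. -/
lemma hasDerivAt_lommelT_sub_one {m ν x : ℝ} (h1 : 0 < m - ν + 1) (h2 : 0 < m + ν + 1)
    (hx : 0 < x) :
    HasDerivAt (lommelT (m - 1) (ν - 1))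
      (lommelT m ν x + (ν - 1) / x * lommelT (m - 1) (ν - 1) x + (x / 2) ^ (m - 1) /
        (Real.Gamma ((m - ν + 1) / 2) * Real.Gamma ((m + ν + 1) / 2))) x := by
  have h := hasDerivAt_rpow_mul_lommelSeries m (a := (m + ν + 1) / 2)
    (b := (m - ν + 1) / 2) (by linarith) (by linarith) hx
  have hT : ∀ y : ℝ, 0 < y → lommelT (m - 1) (ν - 1) y =
      (y / 2) ^ m * lommelSeries ((m + ν + 1) / 2) ((m - ν + 1) / 2 + 1) (y ^ 2 / 4) := by
    intro y hy
    rw [lommelT_eq _ _ hy, lommelSeries_comm]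
    ring_nf
  rw [hT x hx]
  refine (h.congr_of_eventuallyEq ?_).congr_deriv ?_
  · filter_upwards [Ioi_mem_nhds hx] with y hy using hT y hy
  · rw [lommelSeries_eq_add (a := (m + ν + 1) / 2) (b := (m - ν + 1) / 2) (by linarith)
      (by linarith) (x ^ 2 / 4), lommelT_eq m ν hx, lommelSeries_comm ((m - ν + 3) / 2),
      show (m + ν + 1) / 2 + 1 = (m + ν + 3) / 2 by ring,
      show (m - ν + 1) / 2 + 1 = (m - ν + 3) / 2 by ring,
      show m + 1 = m - 1 + (2 : ℕ) by push_cast; ring,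
      Real.rpow_add (by positivity) (m - 1), Real.rpow_natCast]
    ring

/-! ### The antiderivative of `x ^ m * K_ν(x)` -/

/-- Up to a constant `G_{m,ν}` is a primitive of `x ^ m K_ν(x)`: in the derivative every term cancels
except the product of `x K_ν` with the inhomogeneous term of the Lommel equation. -/
lemma hasDerivAt_lommelG {m ν x : ℝ} (h1 : 0 < m - ν + 1) (h2 : 0 < m + ν + 1) (hx : 0 < x) :
    HasDerivAt (lommelG m ν)
      ((2 ^ (m - 1) * Real.Gamma ((m - ν + 1) / 2) * Real.Gamma ((m + ν + 1) / 2))⁻¹ *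
        (x ^ m * besselK ν x)) x := by
  have h := (hasDerivAt_id x).mul (((hasDerivAt_besselK ν hx).mul
    (hasDerivAt_lommelT_sub_one h1 h2 hx)).add
      ((hasDerivAt_besselK_sub_one ν hx).mul (hasDerivAt_lommelT h1 h2 hx)))
  refine h.congr_deriv ?_
  have g1 := (Real.Gamma_pos_of_pos (by linarith : 0 < (m - ν + 1) / 2)).ne'
  have g2 := (Real.Gamma_pos_of_pos (by linarith : 0 < (m + ν + 1) / 2)).ne'
  have hp := (Real.rpow_pos_of_pos (by norm_num : (0 : ℝ) < 2) (m - 1)).ne'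
  have e : x ^ m = x ^ (m - 1) * x := by rw [← Real.rpow_add_one hx.ne']; ring_nf
  rw [Real.div_rpow hx.le (by norm_num), e]
  simp only [id, Pi.add_apply, Pi.mul_apply]
  field_simp
  ring

lemma tendsto_rpow_mul_besselK {s ν : ℝ} (h : |ν| < s) :
    Tendsto (fun x => x ^ s * besselK ν x) (𝓝[>] 0) (𝓝 0) := by
  obtain ⟨a, ha, has⟩ := exists_between h
  have hlim : Tendsto (fun x : ℝ => (2 * a) ^ a / (a - |ν|) * x ^ (s - a)) (𝓝[>] 0) (𝓝 0) := by
    have hc : ContinuousAt (fun x : ℝ => x ^ (s - a)) 0 :=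
      Real.continuousAt_rpow_const _ _ (Or.inr (by linarith))
    have := (hc.tendsto.mono_left nhdsWithin_le_nhds).const_mul ((2 * a) ^ a / (a - |ν|))
      (x := 𝓝[>] (0 : ℝ))
    rwa [Real.zero_rpow (by linarith), mul_zero] at this
  refine squeeze_zero' ?_ ?_ hlim
  · filter_upwards [self_mem_nhdsWithin] with x hx
    exact mul_nonneg (Real.rpow_nonneg (le_of_lt hx) _) (besselK_nonneg _ _)
  · filter_upwards [self_mem_nhdsWithin] with x hx
    have hx' : 0 < x := hx
    calc x ^ s * besselK ν x ≤ x ^ s * ((2 * a) ^ a / (a - |ν|) * x ^ (-a)) := by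
          gcongr; exact besselK_le ha hx'
      _ = _ := by rw [sub_eq_add_neg s, Real.rpow_add hx']; ring

lemma tendsto_lommelG_zero {m ν : ℝ} (h1 : 0 < m - ν + 1) (h2 : 0 < m + ν + 1) :
    Tendsto (lommelG m ν) (𝓝[>] 0) (𝓝 0) := by
  have hK : Tendsto (fun x => x ^ (m + 1) * besselK ν x) (𝓝[>] 0) (𝓝 0) :=
    tendsto_rpow_mul_besselK (abs_lt.2 ⟨by linarith, by linarith⟩)
  have hK' : Tendsto (fun x => x ^ (m + 2) * besselK (ν - 1) x) (𝓝[>] 0) (𝓝 0) :=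
    tendsto_rpow_mul_besselK (abs_lt.2 ⟨by linarith, by linarith⟩)
  have hS : ∀ {a b : ℝ}, 0 < a → 0 < b → Tendsto (fun x : ℝ => lommelSeries a b (x ^ 2 / 4))
      (𝓝[>] 0) (𝓝 (lommelSeries a b 0)) := fun ha hb => by
    have h0 : Tendsto (fun x : ℝ => x ^ 2 / 4) (𝓝[>] 0) (𝓝 0) := by
      have : ContinuousAt (fun x : ℝ => x ^ 2 / 4) 0 := by fun_prop
      simpa using this.tendsto.mono_left nhdsWithin_le_nhds
    exact (continuousAt_lommelSeries_zero ha hb).tendsto.comp h0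
  have h := ((hK.mul (hS (a := (m - ν + 3) / 2) (b := (m + ν + 1) / 2) (by linarith)
    (by linarith))).const_mul (2 ^ m)⁻¹).add ((hK'.mul (hS (a := (m - ν + 3) / 2)
      (b := (m + ν + 3) / 2) (by linarith) (by linarith))).const_mul (2 ^ (m + 1))⁻¹)
  simp only [zero_mul, mul_zero, add_zero] at h
  refine h.congr' ?_
  filter_upwards [self_mem_nhdsWithin] with x hx
  have hx' : 0 < x := hx
  rw [lommelG, lommelT_eq _ _ hx', lommelT_eq _ _ hx', Real.div_rpow hx'.le (by norm_num),
    Real.div_rpow hx'.le (by norm_num), show m + 2 = m + 1 + 1 by ring,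
    Real.rpow_add_one hx'.ne' (m + 1), Real.rpow_add_one hx'.ne' m,
    show m - 1 - (ν - 1) + 3 = m - ν + 3 by ring, show m - 1 + (ν - 1) + 3 = m + ν + 1 by ring,
    show m - 1 + 1 = m by ring]
  ring

/-- The tail integrals `∫_x^∞ tᵐ K_ν(t) dt`: the normalisation of `G_{m,ν}` at infinity is supplied
by the Mellin transform of `K_ν`, and at the origin by `tendsto_lommelG_zero`. -/
lemma integral_Ioi_rpow_mul_besselK {m ν x : ℝ} (h1 : 0 < m - ν + 1) (h2 : 0 < m + ν + 1)
    (hx : 0 ≤ x) :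
    ∫ t in Ioi x, t ^ m * besselK ν t =
      2 ^ (m - 1) * Real.Gamma ((m - ν + 1) / 2) * Real.Gamma ((m + ν + 1) / 2) *
        lommelGt m ν x := by
  set C := 2 ^ (m - 1) * Real.Gamma ((m - ν + 1) / 2) * Real.Gamma ((m + ν + 1) / 2) with hC
  have hC0 : C ≠ 0 := by
    have g1 := Real.Gamma_pos_of_pos (by linarith : 0 < (m - ν + 1) / 2)
    have g2 := Real.Gamma_pos_of_pos (by linarith : 0 < (m + ν + 1) / 2)
    positivity
  obtain ⟨hi, hval⟩ := integrableOn_and_integral_rpow_mul_besselK h1 h2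
  have hG0 : lommelG m ν 0 = 0 := by simp [lommelG]
  have hii : IntervalIntegrable (fun t => t ^ m * besselK ν t) volume 0 x :=
    (intervalIntegrable_iff_integrableOn_Ioc_of_le hx).2 (hi.mono_set Ioc_subset_Ioi_self)
  have hcont : ContinuousOn (lommelG m ν) (Icc 0 x) := by
    intro y hy
    rcases hy.1.eq_or_lt with rfl | hy0
    · have : ContinuousWithinAt (lommelG m ν) (Ioi 0) 0 := by
        rw [ContinuousWithinAt, hG0]; exact tendsto_lommelG_zero h1 h2
      exact (continuousWithinAt_Ioi_iff_Ici.1 this).mono Icc_subset_Ici_self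
    · exact (hasDerivAt_lommelG h1 h2 hy0).continuousAt.continuousWithinAt
  have hftc := intervalIntegral.integral_eq_sub_of_hasDerivAt_of_le hx hcont
    (fun y hy => hasDerivAt_lommelG h1 h2 hy.1) (hii.const_mul _)
  rw [intervalIntegral.integral_const_mul, hG0, ← hC] at hftc
  have hsplit := intervalIntegral.integral_interval_add_Ioi hi (hi.mono_set (Ioi_subset_Ioi hx))
  rw [hval] at hsplit
  rw [lommelGt]
  have : ∫ t in (0 : ℝ)..x, t ^ m * besselK ν t = C * lommelG m ν x := by
    field_simp at hftc; linarith
  linarith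

/-! ### Summing the coefficients -/

lemma Gamma_add_natCast {s : ℝ} (hs : 0 < s) (n : ℕ) :
    Real.Gamma (s + n) = Real.Gamma s * (ascPochhammer ℝ n).eval s := by
  induction n with
  | zero => simp
  | succ n ih =>
    push_cast
    rw [← add_assoc, Real.Gamma_add_one (by positivity), ih, ascPochhammer_succ_eval]
    ring

lemma Gamma_natCast_add_half_mul (j : ℕ) :
    Real.Gamma (j + 1 / 2) * (j.factorial * 4 ^ j) = (2 * j).factorial * √π := by
  have h := Real.Gamma_mul_Gamma_add_half ((j : ℝ) + 1 / 2)
  rw [show (j : ℝ) + 1 / 2 + 1 / 2 = j + 1 by ring, Real.Gamma_nat_eq_factorial,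
    show 2 * ((j : ℝ) + 1 / 2) = ((2 * j : ℕ) : ℝ) + 1 by push_cast; ring,
    Real.Gamma_nat_eq_factorial, show 1 - (((2 * j : ℕ) : ℝ) + 1) = -((2 * j : ℕ) : ℝ) by ring,
    Real.rpow_neg (by norm_num), Real.rpow_natCast, pow_mul] at h
  norm_num at h
  rw [← mul_assoc, h]
  field_simp

lemma ascPochhammer_eval_three_halves_mul (j : ℕ) :
    (ascPochhammer ℝ j).eval (3 / 2) * (j.factorial * 4 ^ j) = (2 * j + 1).factorial := by
  induction j with
  | zero => simp
  | succ j ih =>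
    rw [ascPochhammer_succ_eval, show 2 * (j + 1) + 1 = 2 * j + 1 + 1 + 1 by ring,
      Nat.factorial_succ (2 * j + 1 + 1), Nat.factorial_succ (2 * j + 1), Nat.factorial_succ j]
    push_cast
    rw [← ih]
    ring

/-- The binomial series, with coefficients in terms of gamma functions. -/
lemma hasSum_Gamma_add_natCast {s z : ℝ} (hs : 0 < s) (hz : |z| < 1) :
    HasSum (fun j : ℕ => Real.Gamma (s + j) / j.factorial * z ^ j)
      (Real.Gamma s * (1 / (1 - z) ^ s)) := by
  have h := (Real.one_div_one_sub_rpow_hasFPowerSeriesOnBall_zero s).hasSum (y := z)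
    (by simpa [enorm_eq_nnnorm, ← NNReal.coe_lt_coe] using hz)
  rw [zero_add] at h
  refine (h.mul_left (Real.Gamma s)).congr_fun fun j => ?_
  have h1 := Ring.factorial_nsmul_multichoose_eq_ascPochhammer s j
  rw [Ring.multichoose_eq, Polynomial.ascPochhammer_smeval_eq_eval, nsmul_eq_mul] at h1
  rw [FormalMultilinearSeries.ofScalars_apply_eq, Gamma_add_natCast hs, ← h1, smul_eq_mul]
  field_simp

lemma sq_div_sq_lt_one {α β : ℝ} (hβ : |β| < α) : β ^ 2 / α ^ 2 < 1 := by
  have hα : 0 < α := (abs_nonneg β).trans_lt hβ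
  rw [div_lt_one (by positivity), ← sq_abs]
  exact pow_lt_pow_left₀ hβ (abs_nonneg β) two_ne_zero

lemma vgPrefactor_pos {ν α β : ℝ} (hν : -(1 / 2) < ν) (hβ : |β| < α) : 0 < vgPrefactor ν α β := by
  have h1 : 0 < 1 - β ^ 2 / α ^ 2 := by linarith [sq_div_sq_lt_one hβ]
  have h2 := Real.Gamma_pos_of_pos (by linarith : 0 < ν + 1 / 2)
  rw [vgPrefactor]
  positivity

lemma vgCoeff_neg (ν α β : ℝ) (k : ℕ) : vgCoeff ν α (-β) k = (-1) ^ k * vgCoeff ν α β k := by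
  rw [vgCoeff, vgCoeff, show 2 * -β / α = -1 * (2 * β / α) by ring, mul_pow]
  ring

lemma vgPrefactor_neg (ν α β : ℝ) : vgPrefactor ν α (-β) = vgPrefactor ν α β := by
  simp [vgPrefactor]

lemma hasSum_vgCoeff_even {ν α β : ℝ} (hν : -(1 / 2) < ν) (hβ : |β| < α) :
    HasSum (fun j : ℕ => vgPrefactor ν α β * vgCoeff ν α β (2 * j)) (1 / 2) := by
  have hz := sq_div_sq_lt_one hβ
  have hs : 0 < ν + 1 / 2 := by linarith
  have hg := (Real.Gamma_pos_of_pos hs).ne'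
  have hp := (Real.rpow_pos_of_pos (by linarith : 0 < 1 - β ^ 2 / α ^ 2) (ν + 1 / 2)).ne'
  have hπ : √π ≠ 0 := by positivity
  have h := (hasSum_Gamma_add_natCast hs (z := β ^ 2 / α ^ 2)
    (by rwa [abs_of_nonneg (by positivity)])).mul_left (vgPrefactor ν α β * √π)
  have hval : 1 / 2 = vgPrefactor ν α β * √π *
      (Real.Gamma (ν + 1 / 2) * (1 / (1 - β ^ 2 / α ^ 2) ^ (ν + 1 / 2))) := by
    rw [vgPrefactor]
    generalize (1 - β ^ 2 / α ^ 2) ^ (ν + 1 / 2) = p at hp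
    generalize Real.Gamma (ν + 1 / 2) = g at hg
    field_simp
  rw [hval]
  refine h.congr_fun fun j => ?_
  have hj := Gamma_natCast_add_half_mul j
  rw [vgCoeff, pow_mul, show (2 * β / α) ^ 2 = 4 * (β ^ 2 / α ^ 2) by ring, mul_pow]
  push_cast
  rw [show (2 * (j : ℝ) + 1) / 2 = j + 1 / 2 by ring,
    show ν + ((j : ℝ) + 1 / 2) = ν + 1 / 2 + j by ring]
  have e : Real.Gamma (j + 1 / 2) = (2 * j).factorial * √π / (j.factorial * 4 ^ j) := by
    rw [eq_div_iff (by positivity), hj]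
  rw [e]
  field_simp

/-- The excess `P(X > μ) - 1/2`, which vanishes for a symmetric distribution. -/
noncomputable def vgSkew (ν α β : ℝ) : ℝ :=
  Real.Gamma (ν + 1) / (√π * Real.Gamma (ν + 1 / 2)) * (β / α) *
    (1 - β ^ 2 / α ^ 2) ^ (ν + 1 / 2) *
      ordinaryHypergeometric 1 (ν + 1) (3 / 2 : ℝ) (β ^ 2 / α ^ 2)

lemma vgSkew_neg (ν α β : ℝ) : vgSkew ν α (-β) = -vgSkew ν α β := by
  rw [vgSkew, vgSkew, neg_sq]; ring

lemma hasSum_vgCoeff_odd {ν α β : ℝ} (hν : -(1 / 2) < ν) (hβ : |β| < α) :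
    HasSum (fun j : ℕ => vgPrefactor ν α β * vgCoeff ν α β (2 * j + 1)) (vgSkew ν α β) := by
  have hz := sq_div_sq_lt_one hβ
  have hg := (Real.Gamma_pos_of_pos (by linarith : 0 < ν + 1 / 2)).ne'
  have hπ : √π ≠ 0 := by positivity
  have hr : (ordinaryHypergeometricSeries ℝ 1 (ν + 1) (3 / 2 : ℝ)).radius = 1 :=
    ordinaryHypergeometricSeries_radius_eq_one ℝ _ _ _ fun k => by
      have : (0 : ℝ) ≤ k := k.cast_nonneg
      refine ⟨?_, ?_, ?_⟩ <;> intro h <;> linarith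
  have h := ((ordinaryHypergeometricSeries ℝ 1 (ν + 1) (3 / 2 : ℝ)).hasFPowerSeriesOnBall
    (by simp [hr])).hasSum (y := β ^ 2 / α ^ 2) (by
      rw [hr]
      have : ‖β ^ 2 / α ^ 2‖ < 1 := by rwa [Real.norm_of_nonneg (by positivity)]
      simpa [enorm_eq_nnnorm, ← NNReal.coe_lt_coe] using this)
  rw [zero_add] at h
  have hval : vgSkew ν α β = vgPrefactor ν α β * (2 * (β / α) * Real.Gamma (ν + 1)) *
      (ordinaryHypergeometricSeries ℝ 1 (ν + 1) (3 / 2 : ℝ)).sum (β ^ 2 / α ^ 2) := by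
    rw [vgSkew, vgPrefactor, ordinaryHypergeometric]
    field_simp
  rw [hval]
  refine (h.mul_left (vgPrefactor ν α β * (2 * (β / α) * Real.Gamma (ν + 1)))).congr_fun
    fun j => ?_
  have hj := ascPochhammer_eval_three_halves_mul j
  have hp : (ascPochhammer ℝ j).eval (3 / 2) ≠ 0 := (ascPochhammer_pos j _ (by norm_num)).ne'
  rw [ordinaryHypergeometricSeries_apply_eq, ascPochhammer_eval_one, vgCoeff, ← hj, pow_succ,
    pow_mul, show (2 * β / α) ^ 2 = 4 * (β ^ 2 / α ^ 2) by ring, mul_pow, smul_eq_mul]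
  push_cast
  rw [show (2 * (j : ℝ) + 1 + 1) / 2 = j + 1 by ring, Real.Gamma_nat_eq_factorial,
    show ν + ((j : ℝ) + 1) = ν + 1 + j by ring, Gamma_add_natCast (by linarith)]
  field_simp

lemma hasSum_vgCoeff {ν α β : ℝ} (hν : -(1 / 2) < ν) (hβ : |β| < α) :
    HasSum (fun k : ℕ => vgPrefactor ν α β * vgCoeff ν α β k) (1 / 2 + vgSkew ν α β) :=
  (hasSum_vgCoeff_even hν hβ).even_add_odd (hasSum_vgCoeff_odd hν hβ)

/-! ### Tails of the variance-gamma density -/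

/-- The variance-gamma density with location `0`, as a function on the positive half-line. -/
noncomputable def vgHalfPDF (ν α β u : ℝ) : ℝ :=
  vgNorm ν α β * Real.exp (β * u) * u ^ ν * besselK ν (α * u)

lemma vgNorm_neg (ν α β : ℝ) : vgNorm ν α (-β) = vgNorm ν α β := by
  simp [vgNorm]

lemma vgNorm_abs (ν α β : ℝ) : vgNorm ν α |β| = vgNorm ν α β := by
  simp [vgNorm]

lemma vgNorm_nonneg {ν α β : ℝ} (hν : -(1 / 2) < ν) (hβ : |β| < α) : 0 ≤ vgNorm ν α β := by
  have hα : 0 < α := (abs_nonneg β).trans_lt hβ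
  have h1 : 0 ≤ α ^ 2 - β ^ 2 := by
    rw [← sq_abs β]; nlinarith [abs_nonneg β]
  have h2 := Real.Gamma_pos_of_pos (by linarith : 0 < ν + 1 / 2)
  rw [vgNorm]
  positivity

lemma vgNorm_eq {ν α β : ℝ} (hβ : |β| < α) :
    vgNorm ν α β = vgPrefactor ν α β * (2 * α ^ (ν + 1) / 2 ^ ν) := by
  have hα : 0 < α := (abs_nonneg β).trans_lt hβ
  have hz : 0 ≤ 1 - β ^ 2 / α ^ 2 := by linarith [sq_div_sq_lt_one hβ]
  have e1 : (α ^ 2 - β ^ 2) ^ (ν + 1 / 2) =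
      α ^ ν * α ^ (ν + 1) * (1 - β ^ 2 / α ^ 2) ^ (ν + 1 / 2) := by
    rw [show α ^ 2 - β ^ 2 = α ^ 2 * (1 - β ^ 2 / α ^ 2) by field_simp,
      Real.mul_rpow (by positivity) hz, ← Real.rpow_natCast, ← Real.rpow_mul hα.le,
      ← Real.rpow_add hα]
    congr 2
    push_cast
    ring
  have h2 := (Real.rpow_pos_of_pos hα ν).ne'
  rw [vgNorm, vgPrefactor, e1, Real.mul_rpow (by norm_num) hα.le]
  field_simp

/-- The terms of the expansion of `vgHalfPDF` in powers of `β`. -/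
noncomputable def vgTerm (ν α β : ℝ) (k : ℕ) (u : ℝ) : ℝ :=
  vgNorm ν α β * (β ^ k / k.factorial) * α ^ (-(ν + k)) * ((α * u) ^ (ν + k) * besselK ν (α * u))

lemma hasSum_vgTerm {α u : ℝ} (ν β : ℝ) (hα : 0 < α) (hu : 0 < u) :
    HasSum (fun k => vgTerm ν α β k u) (vgHalfPDF ν α β u) := by
  have h : HasSum (fun k : ℕ => (β * u) ^ k / k.factorial) (Real.exp (β * u)) := by
    rw [Real.exp_eq_exp_ℝ]; exact NormedSpace.expSeries_div_hasSum_exp (β * u)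
  have hval : vgHalfPDF ν α β u =
      vgNorm ν α β * u ^ ν * besselK ν (α * u) * Real.exp (β * u) := by
    rw [vgHalfPDF]; ring
  rw [hval]
  refine (h.mul_left (vgNorm ν α β * u ^ ν * besselK ν (α * u))).congr_fun fun k => ?_
  rw [vgTerm, Real.mul_rpow hα.le hu.le, Real.rpow_neg hα.le, Real.rpow_add_natCast hu.ne',
    mul_pow]
  have := (Real.rpow_pos_of_pos hα (ν + k)).ne'
  field_simp

lemma integrableOn_vgTerm {ν α : ℝ} (β : ℝ) (hν : -(1 / 2) < ν) (hα : 0 < α) (k : ℕ) :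
    IntegrableOn (vgTerm ν α β k) (Ioi 0) := by
  have hk : (0 : ℝ) ≤ k := k.cast_nonneg
  refine Integrable.const_mul ?_ _
  refine (integrableOn_Ioi_comp_mul_left_iff (fun t => t ^ (ν + k) * besselK ν t) 0 hα).2 ?_
  rw [mul_zero]
  exact (integrableOn_and_integral_rpow_mul_besselK (by linarith) (by linarith)).1

lemma integral_vgTerm {ν α β y : ℝ} (hν : -(1 / 2) < ν) (hβ : |β| < α) (hy : 0 ≤ y) (k : ℕ) :
    ∫ u in Ioi y, vgTerm ν α β k u =
      vgPrefactor ν α β * (vgCoeff ν α β k * lommelGt (ν + k) ν (α * y)) := by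
  have hα : 0 < α := (abs_nonneg β).trans_lt hβ
  have hk : (0 : ℝ) ≤ k := k.cast_nonneg
  simp only [vgTerm]
  rw [integral_const_mul, integral_comp_mul_left_Ioi (fun t => t ^ (ν + k) * besselK ν t) y hα,
    integral_Ioi_rpow_mul_besselK (by linarith) (by linarith) (by positivity), vgNorm_eq hβ, vgCoeff,
    show (ν + k - ν + 1) / 2 = ((k : ℝ) + 1) / 2 by ring,
    show (ν + k + ν + 1) / 2 = ν + ((k : ℝ) + 1) / 2 by ring, Real.rpow_neg hα.le,
    Real.rpow_add_natCast hα.ne', Real.rpow_add_one hα.ne', Real.rpow_sub_one two_ne_zero,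
    Real.rpow_add_natCast two_ne_zero, smul_eq_mul, div_pow, mul_pow]
  have := (Real.rpow_pos_of_pos hα ν).ne'
  have := (Real.rpow_pos_of_pos (two_pos : (0 : ℝ) < 2) ν).ne'
  field_simp

lemma lommelGt_zero (m ν : ℝ) : lommelGt m ν 0 = 1 := by simp [lommelGt, lommelG]

lemma norm_vgTerm {ν α β u : ℝ} (hν : -(1 / 2) < ν) (hβ : |β| < α) (hu : 0 < u) (k : ℕ) :
    ‖vgTerm ν α β k u‖ = vgTerm ν α |β| k u := by
  have hα : 0 < α := (abs_nonneg β).trans_lt hβ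
  have h1 := vgNorm_nonneg hν hβ
  have h2 := besselK_nonneg ν (α * u)
  rw [vgTerm, vgTerm, vgNorm_abs, norm_mul, norm_mul, norm_mul, Real.norm_of_nonneg h1, norm_div,
    norm_pow, Real.norm_eq_abs β, Real.norm_of_nonneg (Nat.cast_nonneg _),
    Real.norm_of_nonneg (Real.rpow_nonneg hα.le _), Real.norm_of_nonneg (by positivity)]

/-- Termwise integration of the expansion of the density in powers of `β`. It is justified by the
convergence of the coefficient series at `|β|`. -/
lemma hasSum_integral_vgHalfPDF {ν α β y : ℝ} (hν : -(1 / 2) < ν) (hβ : |β| < α) (hy : 0 ≤ y) :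
    HasSum (fun k : ℕ => vgPrefactor ν α β * (vgCoeff ν α β k * lommelGt (ν + k) ν (α * y)))
      (∫ u in Ioi y, vgHalfPDF ν α β u) := by
  have hα : 0 < α := (abs_nonneg β).trans_lt hβ
  have hβ' : |(|β|)| < α := by rwa [abs_abs]
  have hsub : Ioi y ⊆ Ioi 0 := Ioi_subset_Ioi hy
  have hnn : ∀ k, ∀ u ∈ Ioi (0 : ℝ), 0 ≤ vgTerm ν α |β| k u := fun k u hu => by
    rw [← norm_vgTerm hν hβ hu]; exact norm_nonneg _
  have h := hasSum_integral_of_summable_integral_norm (μ := volume.restrict (Ioi y))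
    (F := vgTerm ν α β) (fun k => (integrableOn_vgTerm β hν hα k).mono_set hsub) ?_
  · rw [setIntegral_congr_fun measurableSet_Ioi
      fun u hu => (hasSum_vgTerm ν β hα (hsub hu)).tsum_eq] at h
    simpa only [integral_vgTerm hν hβ hy] using h
  · refine Summable.of_nonneg_of_le (fun k => integral_nonneg fun u => norm_nonneg _) (fun k => ?_)
      (hasSum_vgCoeff hν hβ').summable
    rw [setIntegral_congr_fun measurableSet_Ioi fun u hu => norm_vgTerm hν hβ (hsub hu) k]
    refine (setIntegral_mono_set (integrableOn_vgTerm _ hν hα k) ?_ hsub.eventuallyLE).trans_eq ?_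
    · filter_upwards [ae_restrict_mem measurableSet_Ioi] with u hu using hnn k u hu
    · rw [integral_vgTerm hν hβ' le_rfl, mul_zero, lommelGt_zero, mul_one]

lemma vgHalfPDF_nonneg {ν α β u : ℝ} (hν : -(1 / 2) < ν) (hβ : |β| < α) (hu : 0 ≤ u) :
    0 ≤ vgHalfPDF ν α β u := by
  have h1 := vgNorm_nonneg hν hβ
  have h2 := besselK_nonneg ν (α * u)
  rw [vgHalfPDF]
  positivity

lemma integrableOn_vgHalfPDF {ν α β : ℝ} (hν : -(1 / 2) < ν) (hβ : |β| < α) :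
    IntegrableOn (vgHalfPDF ν α β) (Ioi 0) := by
  have hα : 0 < α := (abs_nonneg β).trans_lt hβ
  have hβ' : |(|β|)| < α := by rwa [abs_abs]
  -- For `|β|` the series for the integral has nonnegative terms and a positive first term, so the
  -- integral is nonzero, and hence not the junk value of a divergent integral.
  have hpos : IntegrableOn (vgHalfPDF ν α |β|) (Ioi 0) := by
    refine Integrable.of_integral_ne_zero (ne_of_gt ?_)
    have h := hasSum_integral_vgHalfPDF hν hβ' le_rfl
    simp only [mul_zero, lommelGt_zero, mul_one] at h
    have hc : ∀ k : ℕ, 0 ≤ vgCoeff ν α |β| k := fun k => by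
      have hk : (0 : ℝ) ≤ k := k.cast_nonneg
      have h1 := Real.Gamma_pos_of_pos (by linarith : 0 < ν + ((k : ℝ) + 1) / 2)
      have h2 := Real.Gamma_pos_of_pos (by linarith : 0 < ((k : ℝ) + 1) / 2)
      rw [vgCoeff]; positivity
    have hp := vgPrefactor_pos hν hβ'
    refine lt_of_lt_of_le ?_ (le_hasSum h 0 fun k _ => mul_nonneg hp.le (hc k))
    have h1 := Real.Gamma_pos_of_pos (by linarith : 0 < ν + 1 / 2)
    have h2 := Real.Gamma_pos_of_pos (by norm_num : (0 : ℝ) < 1 / 2)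
    refine mul_pos hp ?_
    simp only [vgCoeff, CharP.cast_eq_zero, zero_add, pow_zero, Nat.factorial_zero]
    positivity
  refine Integrable.mono' hpos ?_ ?_
  · have := measurable_besselK ν
    unfold vgHalfPDF
    fun_prop
  · filter_upwards [ae_restrict_mem measurableSet_Ioi] with u hu
    have hu' : 0 < u := hu
    rw [Real.norm_of_nonneg (vgHalfPDF_nonneg hν hβ hu'.le), vgHalfPDF, vgHalfPDF, vgNorm_abs]
    have h1 := vgNorm_nonneg hν hβ
    have h2 := besselK_nonneg ν (α * u)
    gcongr
    exact le_abs_self β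

/-! ### The distribution function -/

lemma vgMeasure_Ioi {ν α β μ x : ℝ} (hν : -(1 / 2) < ν) (hβ : |β| < α) (hx : μ ≤ x) :
    vgMeasure ν α β μ (Ioi x) = ENNReal.ofReal (∫ u in Ioi (x - μ), vgHalfPDF ν α β u) := by
  have hsub : Ioi (x - μ) ⊆ Ioi 0 := Ioi_subset_Ioi (by linarith)
  have hnn : ∀ᵐ u ∂volume.restrict (Ioi (x - μ)), 0 ≤ vgHalfPDF ν α β u := by
    filter_upwards [ae_restrict_mem measurableSet_Ioi] with u hu
      using vgHalfPDF_nonneg hν hβ (le_of_lt (hsub hu))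
  rw [ofReal_integral_eq_lintegral_ofReal ((integrableOn_vgHalfPDF hν hβ).mono_set hsub) hnn,
    vgMeasure, withDensity_apply _ measurableSet_Ioi,
    ← (measurePreserving_sub_right volume μ).setLIntegral_comp_preimage_emb
      (MeasurableEquiv.subRight μ).measurableEmbedding
      (fun u => ENNReal.ofReal (vgHalfPDF ν α β u)) (Ioi (x - μ)),
    show (fun y : ℝ => y - μ) ⁻¹' Ioi (x - μ) = Ioi x by ext y; simp]
  refine setLIntegral_congr_fun measurableSet_Ioi fun y hy => ?_
  have : 0 < y - μ := by have : x < y := hy; linarith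
  simp only [vgPDF, vgHalfPDF, abs_of_pos this]

/-- Reflection in the location parameter exchanges `β` and `-β`. -/
lemma vgMeasure_Iio {ν α β μ x : ℝ} (hν : -(1 / 2) < ν) (hβ : |β| < α) (hx : x ≤ μ) :
    vgMeasure ν α β μ (Iio x) = ENNReal.ofReal (∫ u in Ioi (μ - x), vgHalfPDF ν α (-β) u) := by
  have h := vgMeasure_Ioi (β := -β) (μ := -μ) (x := -x) hν (by rwa [abs_neg]) (by linarith)
  rw [show -x - -μ = μ - x by ring] at h
  rw [← h, vgMeasure, vgMeasure, withDensity_apply _ measurableSet_Iio,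
    withDensity_apply _ measurableSet_Ioi,
    ← (Measure.measurePreserving_neg volume).setLIntegral_comp_preimage_emb
      (MeasurableEquiv.neg ℝ).measurableEmbedding
      (fun u => ENNReal.ofReal (vgPDF ν α (-β) (-μ) u)) (Ioi (-x)),
    show Neg.neg ⁻¹' Ioi (-x) = Iio x by ext y; simp]
  refine setLIntegral_congr_fun measurableSet_Iio fun y _ => ?_
  simp only [vgPDF, vgNorm_neg, show -y - -μ = -(y - μ) by ring, abs_neg, neg_mul_neg]

lemma vgMeasure_Iic {ν α β μ x : ℝ} (hν : -(1 / 2) < ν) (hβ : |β| < α) (hx : x ≤ μ) :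
    vgMeasure ν α β μ (Iic x) = ENNReal.ofReal (∫ u in Ioi (μ - x), vgHalfPDF ν α (-β) u) := by
  rw [← vgMeasure_Iio hν hβ hx]
  exact measure_congr ((withDensity_absolutelyContinuous _ _).ae_eq Iio_ae_eq_Iic).symm

lemma integral_vgHalfPDF {ν α β : ℝ} (hν : -(1 / 2) < ν) (hβ : |β| < α) :
    ∫ u in Ioi 0, vgHalfPDF ν α β u = 1 / 2 + vgSkew ν α β := by
  have h := hasSum_integral_vgHalfPDF hν hβ le_rfl
  simp only [mul_zero, lommelGt_zero, mul_one] at h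
  exact h.unique (hasSum_vgCoeff hν hβ)

lemma integral_vgHalfPDF_nonneg {ν α β y : ℝ} (hν : -(1 / 2) < ν) (hβ : |β| < α) (hy : 0 ≤ y) :
    0 ≤ ∫ u in Ioi y, vgHalfPDF ν α β u :=
  setIntegral_nonneg measurableSet_Ioi fun _ hu => vgHalfPDF_nonneg hν hβ (hy.trans (le_of_lt hu))

lemma isProbabilityMeasure_vgMeasure {ν α β : ℝ} (μ : ℝ) (hν : -(1 / 2) < ν) (hβ : |β| < α) :
    IsProbabilityMeasure (vgMeasure ν α β μ) := by
  have hβ' : |(-β)| < α := by rwa [abs_neg]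
  refine ⟨?_⟩
  rw [← Iic_union_Ioi (a := μ), measure_union (Iic_disjoint_Ioi le_rfl) measurableSet_Ioi,
    vgMeasure_Iic hν hβ le_rfl, vgMeasure_Ioi hν hβ le_rfl,
    ← ENNReal.ofReal_add (integral_vgHalfPDF_nonneg hν hβ' (by simp))
      (integral_vgHalfPDF_nonneg hν hβ (by simp)), sub_self,
    integral_vgHalfPDF hν hβ, integral_vgHalfPDF hν hβ', vgSkew_neg,
    show 1 / 2 + -vgSkew ν α β + (1 / 2 + vgSkew ν α β) = 1 by ring, ENNReal.ofReal_one]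

end VarianceGamma

open VarianceGamma Set

theorem theorem1 {Ω : Type*} [MeasurableSpace Ω] (P : Measure Ω) (X : Ω → ℝ)
    (ν α β μ : ℝ) (hν : -(1 / 2) < ν) (hβ : |β| < α)
    (hX : ProbabilityTheory.HasLaw X (VarianceGamma.vgMeasure ν α β μ) P) :
    IsProbabilityMeasure P ∧
    (∀ x : ℝ, μ ≤ x →
      Summable (fun k : ℕ => VarianceGamma.vgCoeff ν α β k *
        VarianceGamma.lommelGt (ν + k) ν (α * (x - μ))) ∧
      P.real {ω | X ω ≤ x} =
        1 - VarianceGamma.vgPrefactor ν α β *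
          ∑' k : ℕ, VarianceGamma.vgCoeff ν α β k *
            VarianceGamma.lommelGt (ν + k) ν (α * (x - μ))) ∧
    (∀ x : ℝ, x < μ →
      Summable (fun k : ℕ => (-1) ^ k * VarianceGamma.vgCoeff ν α β k *
        VarianceGamma.lommelGt (ν + k) ν (-α * (x - μ))) ∧
      P.real {ω | X ω ≤ x} =
        VarianceGamma.vgPrefactor ν α β *
          ∑' k : ℕ, (-1) ^ k * VarianceGamma.vgCoeff ν α β k *
            VarianceGamma.lommelGt (ν + k) ν (-α * (x - μ))) ∧
    (∀ x : ℝ,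
      Summable (fun k : ℕ => Real.sign (x - μ) ^ (k + 1) * VarianceGamma.vgCoeff ν α β k *
        VarianceGamma.lommelG (ν + k) ν (α * |x - μ|)) ∧
      P.real {ω | X ω ≤ x} =
        1 / 2
          - Real.Gamma (ν + 1) / (√Real.pi * Real.Gamma (ν + 1 / 2)) * (β / α) *
              (1 - β ^ 2 / α ^ 2) ^ (ν + 1 / 2) *
              ordinaryHypergeometric 1 (ν + 1) (3 / 2 : ℝ) (β ^ 2 / α ^ 2)
          + VarianceGamma.vgPrefactor ν α β *
            ∑' k : ℕ, Real.sign (x - μ) ^ (k + 1) * VarianceGamma.vgCoeff ν α β k *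
              VarianceGamma.lommelG (ν + k) ν (α * |x - μ|)) := by
  have := isProbabilityMeasure_vgMeasure μ hν hβ
  have hP : IsProbabilityMeasure P := hX.isProbabilityMeasure
  have hβ' : |(-β)| < α := by rwa [abs_neg]
  have hpre := (vgPrefactor_pos hν hβ).ne'
  have hcdf : ∀ x, P.real {ω | X ω ≤ x} = (vgMeasure ν α β μ).real (Iic x) := fun x =>
    hX.measureReal_eq measurableSet_Iic
  have hright : ∀ x, μ ≤ x → HasSum (fun k : ℕ => vgPrefactor ν α β * (vgCoeff ν α β k *
      lommelGt (ν + k) ν (α * (x - μ)))) (1 - P.real {ω | X ω ≤ x}) := by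
    intro x hx
    have hx0 : 0 ≤ x - μ := sub_nonneg.2 hx
    have h := hasSum_integral_vgHalfPDF hν hβ hx0
    rw [hcdf, ← probReal_compl_eq_one_sub measurableSet_Iic, compl_Iic, Measure.real,
      vgMeasure_Ioi hν hβ hx, ENNReal.toReal_ofReal (integral_vgHalfPDF_nonneg hν hβ hx0)]
    exact h
  have hleft : ∀ x, x ≤ μ → HasSum (fun k : ℕ => vgPrefactor ν α β * ((-1) ^ k * vgCoeff ν α β k *
      lommelGt (ν + k) ν (-α * (x - μ)))) (P.real {ω | X ω ≤ x}) := by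
    intro x hx
    have hx0 : 0 ≤ μ - x := sub_nonneg.2 hx
    have h := hasSum_integral_vgHalfPDF hν hβ' hx0
    simp only [vgPrefactor_neg, vgCoeff_neg] at h
    rw [hcdf, Measure.real, vgMeasure_Iic hν hβ hx,
      ENNReal.toReal_ofReal (integral_vgHalfPDF_nonneg hν hβ' hx0),
      show -α * (x - μ) = α * (μ - x) by ring]
    exact h
  have hsum : ∀ {f : ℕ → ℝ} {a : ℝ}, HasSum (fun k => vgPrefactor ν α β * f k) a →
      Summable f ∧ a = vgPrefactor ν α β * ∑' k, f k := fun h =>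
    ⟨(summable_mul_left_iff hpre).1 h.summable, by rw [← tsum_mul_left, h.tsum_eq]⟩
  have hskew : vgSkew ν α β = Real.Gamma (ν + 1) / (√Real.pi * Real.Gamma (ν + 1 / 2)) * (β / α) *
      (1 - β ^ 2 / α ^ 2) ^ (ν + 1 / 2) *
      ordinaryHypergeometric 1 (ν + 1) (3 / 2 : ℝ) (β ^ 2 / α ^ 2) := rfl
  rw [← hskew]
  refine ⟨hP, fun x hx => ?_, fun x hx => hsum (hleft x hx.le), fun x => ?_⟩
  · obtain ⟨h1, h2⟩ := hsum (hright x hx)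
    exact ⟨h1, by linarith⟩
  -- The third formula follows from the first two on writing `G̃ = 1 - G` and summing the
  -- coefficients at `β` for `x > μ`, at `-β` for `x < μ`.
  · have h : HasSum (fun k : ℕ => vgPrefactor ν α β * (Real.sign (x - μ) ^ (k + 1) *
        vgCoeff ν α β k * lommelG (ν + k) ν (α * |x - μ|)))
        (P.real {ω | X ω ≤ x} - (1 / 2 - vgSkew ν α β)) := by
      rcases lt_trichotomy x μ with hx | rfl | hx
      · have hc := hasSum_vgCoeff hν hβ'
        simp only [vgPrefactor_neg, vgCoeff_neg, vgSkew_neg, ← sub_eq_add_neg] at hc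
        refine ((hleft x hx.le).sub hc).congr_fun fun k => ?_
        rw [Real.sign_of_neg (sub_neg.2 hx), abs_of_neg (sub_neg.2 hx), lommelGt, pow_succ,
          neg_mul_comm]
        ring
      · have h0 := (hright x le_rfl).unique (a₂ := 1 / 2 + vgSkew ν α β) (by
          simpa [lommelGt_zero] using hasSum_vgCoeff hν hβ)
        rw [show P.real {ω | X ω ≤ x} - (1 / 2 - vgSkew ν α β) = 0 by linarith]
        simp
      · rw [show P.real {ω | X ω ≤ x} - (1 / 2 - vgSkew ν α β) =
          1 / 2 + vgSkew ν α β - (1 - P.real {ω | X ω ≤ x}) by ring]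
        refine ((hasSum_vgCoeff hν hβ).sub (hright x hx.le)).congr_fun fun k => ?_
        rw [Real.sign_of_pos (sub_pos.2 hx), abs_of_pos (sub_pos.2 hx), lommelGt, one_pow]
        ring
    obtain ⟨h1, h2⟩ := hsum h
    exact ⟨h1, by linarith⟩
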